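/- Identify a square with a pair $(i,j)$ of positive integers, $i$ being its column (counted from the left) and $j$ its row (counted from the bottom). Let $F=\{1,\dots,n\}\times\{1,\dots,m\}$ be a rectangular Ferrers board with $n$ columns and $m$ rows, and let $P$ be a rook placement on $F$, i.e. a subset of $F$ with at most one square in each row and at most one in each column. Let $\mathrm{ins}(P)$ denote the Robinson--Schensted insertion tableau of $P$, obtained by inserting, by row insertion, the row indices of the squares of $P$ in order of increasing column. Let $1\le a<b\le n$ and suppose that $P$ has no square in column $a$. A decreasing sequence is a sequence of squares of $P$ whose columns strictly increase and whose rows strictly decrease. Let $k\ge 0$ be the greatest length of a decreasing sequence in $P$ all of whose squares lie in the columns $a,a+1,\dots,b$. Among these sequences of length $k$, let $S=S_1\dots S_k$ be the one whose sequence of row indices $(\mathrm{row}(S_1),\dots,\mathrm{row}(S_k))$ is lexicographically smallest. Let $P(a\leftarrow S)$ be the placement obtained from $P$ by moving, simultaneously and within their rows, the square $S_1$ to column $a$ and each square $S_i$ with $1<i\le k$ to the column of $S_{i-1}$, all other squares of $P$ staying where they are. (If $k=0$, then $P(a\leftarrow S)=P$.) Then $$\mathrm{ins}(P)=\mathrm{ins}\bigl(P(a\leftarrow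 S)\bigr).$$ -/

import Mathlib

/-! Squares are pairs `(i, j) : ℕ × ℕ`: column `i` from the left, row `j` from the bottom,
both counted from 1. -/

namespace RookPlacement

/-- The rectangular Ferrers board with `n` columns and `m` rows. -/
def rectBoard (n m : ℕ) : Finset (ℕ × ℕ) := Finset.Icc 1 n ×ˢ Finset.Icc 1 m

/-- `P` is a rook placement on the board `F`: a subset of `F` with at most one square in each
column and at most one square in each row. -/
def IsPlacement (F P : Finset (ℕ × ℕ)) : Prop :=
  P ⊆ F ∧ (∀ X ∈ P, ∀ Y ∈ P, X.1 = Y.1 → X = Y) ∧ (∀ X ∈ P, ∀ Y ∈ P, X.2 = Y.2 → X = Y)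

/-- The restriction of `P` to the columns `a, a + 1, …, b`. -/
def restrictCols (a b : ℕ) (P : Finset (ℕ × ℕ)) : Finset (ℕ × ℕ) :=
  P.filter fun X => a ≤ X.1 ∧ X.1 ≤ b

/-- `S` is a decreasing sequence in `P`: a list of squares of `P`, from left to right,
each one lying strictly to the right of and strictly below the previous ones. -/
def IsDecreasingSeq (P : Finset (ℕ × ℕ)) (S : List (ℕ × ℕ)) : Prop :=
  (∀ X ∈ S, X ∈ P) ∧ S.Pairwise fun X Y => X.1 < Y.1 ∧ Y.2 < X.2

/-- `S` is a decreasing sequence in `P` of the greatest possible length. -/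
def IsLongestDecreasing (P : Finset (ℕ × ℕ)) (S : List (ℕ × ℕ)) : Prop :=
  IsDecreasingSeq P S ∧ ∀ T, IsDecreasingSeq P T → T.length ≤ S.length

/-- `S` is smallest among the longest decreasing sequences in `P`, where sequences are compared
lexicographically by their values, that is, by the rows of their squares read from left to
right (`≤` on `List ℕ` is the lexicographic order). -/
def IsSmallestLongestDecreasing (P : Finset (ℕ × ℕ)) (S : List (ℕ × ℕ)) : Prop :=
  IsLongestDecreasing P S ∧
    ∀ T, IsLongestDecreasing P T → S.map Prod.snd ≤ T.map Prod.snd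

theorem finite_isDecreasingSeq (P : Finset (ℕ × ℕ)) : {S | IsDecreasingSeq P S}.Finite := by
  refine ((List.finite_length_le P P.card).image (List.map Subtype.val)).subset ?_
  rintro S ⟨hS, hp⟩
  refine ⟨S.attachWith (· ∈ P) hS, ?_, List.attachWith_map_subtype_val hS⟩
  have hnd : S.Nodup := hp.imp fun {X Y} h e => by simp [e] at h
  have h1 : S.toFinset ⊆ P := fun X hX => hS X (by simpa using hX)
  have h2 := Finset.card_le_card h1
  rw [List.toFinset_card_of_nodup hnd] at h2
  simpa using h2

theorem exists_isSmallestLongestDecreasing (P : Finset (ℕ × ℕ)) :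
    ∃ S, IsSmallestLongestDecreasing P S := by
  have hfin := finite_isDecreasingSeq P
  obtain ⟨S, hS, hmax⟩ := Set.exists_max_image {S | IsDecreasingSeq P S} List.length hfin
    ⟨[], by simp [IsDecreasingSeq]⟩
  obtain ⟨T, hT, hmin⟩ := Set.exists_min_image {S | IsLongestDecreasing P S}
    (List.map Prod.snd) (hfin.subset fun _ h => h.1) ⟨S, hS, hmax⟩
  exact ⟨T, hT, hmin⟩

/-- In a rook placement the smallest longest decreasing sequence is unique. -/
theorem IsSmallestLongestDecreasing.unique {F P : Finset (ℕ × ℕ)} (hP : IsPlacement F P)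
    {a b : ℕ} {S T : List (ℕ × ℕ)} (hS : IsSmallestLongestDecreasing (restrictCols a b P) S)
    (hT : IsSmallestLongestDecreasing (restrictCols a b P) T) : S = T := by
  have h := le_antisymm (hS.2 T hT.1) (hT.2 S hS.1)
  have mem : ∀ X, X ∈ restrictCols a b P → X ∈ P := fun X hX => (Finset.mem_filter.mp hX).1
  have key : ∀ S T : List (ℕ × ℕ), (∀ X ∈ S, X ∈ P) → (∀ X ∈ T, X ∈ P) →
      S.map Prod.snd = T.map Prod.snd → S = T := by
    intro S
    induction S with
    | nil =>
      rintro (_ | ⟨Y, T⟩) _ _ h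
      · rfl
      · simp at h
    | cons X S ih =>
      rintro (_ | ⟨Y, T⟩) h1 h2 h
      · simp at h
      · simp only [List.map_cons, List.cons.injEq] at h
        rw [hP.2.2 X (h1 X (by simp)) Y (h2 Y (by simp)) h.1,
          ih T (fun Z hZ => h1 Z (by simp [hZ])) (fun Z hZ => h2 Z (by simp [hZ])) h.2]
  exact key S T (fun X hX => mem X (hS.1.1.1 X hX)) (fun X hX => mem X (hT.1.1.1 X hX)) h

/-- The lexicographically smallest among the longest decreasing sequences of `P` restricted to
the columns `a, …, b`. -/
noncomputable def ds (a b : ℕ) (P : Finset (ℕ × ℕ)) : List (ℕ × ℕ) :=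
  (exists_isSmallestLongestDecreasing (restrictCols a b P)).choose

theorem ds_spec (a b : ℕ) (P : Finset (ℕ × ℕ)) :
    IsSmallestLongestDecreasing (restrictCols a b P) (ds a b P) :=
  (exists_isSmallestLongestDecreasing (restrictCols a b P)).choose_spec

/-- For `S = S₁ … Sₖ`, listed from left to right, the squares obtained by moving `S₁` along its
row to column `c` and each `Sᵢ`, `i > 1`, along its row to the column of `Sᵢ₋₁`
(`List.zip` drops the unused last column). -/
def leftShiftSeq (c : ℕ) (S : List (ℕ × ℕ)) : List (ℕ × ℕ) :=
  List.zip (c :: S.map Prod.fst) (S.map Prod.snd)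

/-- The left-shift `P(c ← S)`: the markers of `S` are moved to `leftShiftSeq c S`, the others
stay where they are. -/
def leftShift (P : Finset (ℕ × ℕ)) (c : ℕ) (S : List (ℕ × ℕ)) : Finset (ℕ × ℕ) :=
  (P \ S.toFinset) ∪ (leftShiftSeq c S).toFinset

/-- Insert `x` into a row: it replaces the leftmost entry larger than `x`, which is bumped (second
component), or is put at the right end if there is no such entry. -/
def rowInsert (x : ℕ) : List ℕ → List ℕ × Option ℕ
  | [] => ([x], none)
  | y :: ys => if x < y then (x :: ys, some y)
      else (y :: (rowInsert x ys).1, (rowInsert x ys).2)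

/-- Robinson-Schensted insertion of `x` into a tableau, given as the list of its rows from the
top: an entry bumped from one row is inserted into the next row. -/
def tableauInsert (x : ℕ) : List (List ℕ) → List (List ℕ)
  | [] => [[x]]
  | r :: T =>
    match rowInsert x r with
    | (r', none) => r' :: T
    | (r', some y) => r' :: tableauInsert y T

/-- The bottom line of the partial permutation of `P`: the rows of its squares, listed by
increasing column. -/
def word (P : Finset (ℕ × ℕ)) : List ℕ :=
  ((P.map toLex.toEmbedding).sort (· ≤ ·)).map fun X => (ofLex X).2

/-- The Robinson-Schensted insertion tableau of (the partial permutation of) `P`. -/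
def ins (P : Finset (ℕ × ℕ)) : List (List ℕ) :=
  (word P).foldl (fun T x => tableauInsert x T) []

end RookPlacement

/-! Knuth-related words act alike on every tableau with sorted rows (`KnuthPair.wordEquiv`), so the
squares outside the columns a, …, b play no role. It remains to compare the words of these columns
before and after the shift. They are shown to have the same column insertion tableau `colTab`, built
from right to left, and words with equal `colTab` are equivalent (`wordEquiv_of_colTab_eq`).

Reading from right to left, the shift delays each letter of S until the column of the preceding
square of S. While a letter is delayed, the shifted tableau is the unshifted one with this letter
deleted from the first column and the hole filled by a jeu de taquin slide (`Slide`).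
`slide_tabInsert_aux` shows that suitable insertions preserve this relation; lexicographic
minimality makes the letters land suitably (`Shift.slide`). In column a the last delayed letter is
inserted. The hole then lies beyond the end of the first column, because S is longest, so the two
tableaux coincide (`Shift.wordEquiv`). -/

namespace RookPlacement

/-! ### Row insertion of words -/

/-- Insert the letters of a word, from left to right, into a tableau. -/
def insertWord (w : List ℕ) (T : List (List ℕ)) : List (List ℕ) :=
  w.foldl (fun T x => tableauInsert x T) T

/-- Insert the letters of a word, from left to right, into a row; the second component is the
word of bumped letters. -/
def rowInsertWord : List ℕ → List ℕ → List ℕ × List ℕ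
  | [], r => (r, [])
  | x :: w, r =>
    ((rowInsertWord w (rowInsert x r).1).1,
      (rowInsert x r).2.toList ++ (rowInsertWord w (rowInsert x r).1).2)

theorem insertWord_append (u v : List ℕ) (T : List (List ℕ)) :
    insertWord (u ++ v) T = insertWord v (insertWord u T) := List.foldl_append

/-- The lower rows only see the letters bumped from the first one, in the order of bumping; this
permits induction on the rows. -/
theorem insertWord_cons_row (w r : List ℕ) (T : List (List ℕ)) :
    insertWord w (r :: T) =
      (rowInsertWord w r).1 :: insertWord (rowInsertWord w r).2 T := by
  induction w generalizing r T with
  | nil => rfl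
  | cons x w ih =>
    have h : insertWord (x :: w) (r :: T) = insertWord w (tableauInsert x (r :: T)) := rfl
    rw [h]
    simp only [tableauInsert, rowInsertWord]
    rcases hx : rowInsert x r with ⟨r', _ | y⟩
    · simp [ih]
    · simp only [ih, Option.toList_some, List.cons_append, List.nil_append]
      rfl

theorem mem_rowInsert {x z : ℕ} {r : List ℕ} (h : z ∈ (rowInsert x r).1) : z = x ∨ z ∈ r := by
  induction r with
  | nil => simpa [rowInsert] using h
  | cons y r ih =>
    simp only [rowInsert] at h
    split_ifs at h <;> simp at h ⊢ <;> tauto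

theorem mem_of_rowInsert_snd {x z : ℕ} {r : List ℕ} (h : (rowInsert x r).2 = some z) : z ∈ r := by
  induction r with
  | nil => simp [rowInsert] at h
  | cons y r ih =>
    simp only [rowInsert] at h
    split_ifs at h <;> simp at h ⊢ <;> tauto

theorem lt_of_rowInsert_snd {x z : ℕ} {r : List ℕ} (h : (rowInsert x r).2 = some z) : x < z := by
  induction r with
  | nil => simp [rowInsert] at h
  | cons y r ih =>
    simp only [rowInsert] at h
    split_ifs at h with hxy
    · simp at h; omega
    · exact ih h

theorem pairwise_rowInsert {x : ℕ} {r : List ℕ} (hr : r.Pairwise (· ≤ ·)) :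
    (rowInsert x r).1.Pairwise (· ≤ ·) := by
  induction r with
  | nil => simp [rowInsert]
  | cons y r ih =>
    rw [List.pairwise_cons] at hr
    simp only [rowInsert]
    split_ifs with h
    · exact List.pairwise_cons.2 ⟨fun z hz => h.le.trans (hr.1 z hz), hr.2⟩
    · refine List.pairwise_cons.2 ⟨fun z hz => ?_, ih hr.2⟩
      rcases mem_rowInsert hz with rfl | hz
      · omega
      · exact hr.1 z hz

/-- A larger letter, inserted afterwards, bumps a larger letter. -/
theorem rowInsert_rowInsert_le {y z q : ℕ} (hyz : y ≤ z) {r : List ℕ} (hr : r.Pairwise (· ≤ ·))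
    (h : (rowInsert z (rowInsert y r).1).2 = some q) :
    ∃ p, (rowInsert y r).2 = some p ∧ p ≤ q := by
  induction r with
  | nil => simp [rowInsert, Nat.not_lt.2 hyz] at h
  | cons g r ih =>
    rw [List.pairwise_cons] at hr
    simp only [rowInsert] at h ⊢
    split_ifs at h ⊢ with hyg
    · simp only [rowInsert, Nat.not_lt.2 hyz, if_false] at h
      exact ⟨g, rfl, hr.1 q (mem_of_rowInsert_snd h)⟩
    · have : ¬ z < g := by omega
      simp only [rowInsert, this, if_false] at h
      exact ih hr.2 h

/-- A smaller letter, inserted afterwards, bumps a letter at most equal to the first one. -/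
theorem rowInsert_rowInsert_of_lt {y z : ℕ} (hyz : y < z) {r : List ℕ} :
    ∃ p, (rowInsert y (rowInsert z r).1).2 = some p ∧ p ≤ z := by
  induction r with
  | nil => exact ⟨z, by simp [rowInsert, hyz], le_rfl⟩
  | cons g r ih =>
    by_cases hzg : z < g
    · exact ⟨z, by simp [rowInsert, hzg, hyz], le_rfl⟩
    · by_cases hyg : y < g
      · exact ⟨g, by simp [rowInsert, hzg, hyg], by omega⟩
      · simpa [rowInsert, hzg, hyg] using ih

/-! ### Knuth relations and their invariance -/

/-- The elementary Knuth relations. -/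
inductive KnuthPair : List ℕ → List ℕ → Prop
  | low {x y z : ℕ} (hxy : x < y) (hyz : y ≤ z) : KnuthPair [y, z, x] [y, x, z]
  | high {x y z : ℕ} (hxy : x ≤ y) (hyz : y < z) : KnuthPair [x, z, y] [z, x, y]

/-- If the smallest letter x passes the first entry g of the row, all three letters do, and
induction applies. Otherwise the bumped words are compared directly. -/
theorem KnuthPair.rowInsertWord {u v : List ℕ} (h : KnuthPair u v) {r : List ℕ}
    (hr : r.Pairwise (· ≤ ·)) :
    (rowInsertWord u r).1 = (rowInsertWord v r).1 ∧
      ((rowInsertWord u r).2 = (rowInsertWord v r).2 ∨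
        KnuthPair (rowInsertWord u r).2 (rowInsertWord v r).2) := by
  induction r with
  | nil =>
    rcases h with ⟨hxy, hyz⟩ | ⟨hxy, hyz⟩
    · simp [RookPlacement.rowInsertWord, rowInsert, hxy, Nat.not_lt.2 hyz,
        Nat.not_lt.2 (hxy.le.trans hyz)]
    · simp [RookPlacement.rowInsertWord, rowInsert, hyz, hxy.trans_lt hyz, Nat.not_lt.2 hxy,
        Nat.not_lt.2 (hxy.trans hyz.le)]
  | cons g r ih =>
    rw [List.pairwise_cons] at hr
    have ih := ih hr.2
    rcases h with @⟨x, y, z, hxy, hyz⟩ | @⟨x, y, z, hxy, hyz⟩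
    · by_cases hxg : x < g
      · by_cases hyg : y < g
        · have h1 : ¬ z < y := by omega
          have h2 : ¬ z < x := by omega
          simp only [RookPlacement.rowInsertWord, rowInsert, hyg, hxy, h1, h2, if_true, if_false,
            true_and]
          rcases hz : (rowInsert z r).2 with _ | q
          · simp
          · right
            exact .low hyg (hr.1 q (mem_of_rowInsert_snd hz))
        · have h1 : ¬ z < g := by omega
          have h2 : ¬ z < x := by omega
          simp only [RookPlacement.rowInsertWord, rowInsert, hxg, hyg, h1, h2, if_true, if_false,
            true_and]
          rcases hz : (rowInsert z (rowInsert y r).1).2 with _ | q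
          · simp
          · obtain ⟨p, hp, hpq⟩ := rowInsert_rowInsert_le hyz hr.2 hz
            rw [hp]
            have := lt_of_rowInsert_snd hp
            right
            exact .low (by omega) hpq
      · have h1 : ¬ y < g := by omega
        have h2 : ¬ z < g := by omega
        simpa [RookPlacement.rowInsertWord, rowInsert, hxg, h1, h2] using ih
    · by_cases hxg : x < g
      · have h1 : ¬ y < x := by omega
        have h2 : ¬ z < x := by omega
        by_cases hzg : z < g
        · have h3 : x < z := by omega
          simp only [RookPlacement.rowInsertWord, rowInsert, hxg, hzg, h1, h2, h3, if_true, if_false]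
          -- A `high` pair turns into a `low` one here: the bumped words are g, k, z and g, z, k
          -- with z < g ≤ k.
          rcases r with _ | ⟨k, r⟩
          · simp [rowInsert, hyz]
          · have hgk := hr.1 k (by simp)
            have h4 : z < k := by omega
            have h5 : y < k := by omega
            simp only [rowInsert, h4, h5, hyz, if_true, true_and]
            right
            exact .low hzg hgk
        · simp only [RookPlacement.rowInsertWord, rowInsert, hxg, hzg, h1, h2, if_true, if_false,
            true_and]
          rcases hz : (rowInsert z r).2 with _ | q
          · simp
          · obtain ⟨p, hp, hpz⟩ := rowInsert_rowInsert_of_lt hyz (r := r)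
            rw [hp]
            have hzq := lt_of_rowInsert_snd hz
            have hgp : g ≤ p := by
              rcases mem_rowInsert (mem_of_rowInsert_snd hp) with rfl | h
              · omega
              · exact hr.1 p h
            right
            exact .high hgp (by omega)
      · have h1 : ¬ y < g := by omega
        have h2 : ¬ z < g := by omega
        simpa [RookPlacement.rowInsertWord, rowInsert, hxg, h1, h2] using ih

/-- All rows of `T` are weakly increasing. -/
def RowsSorted (T : List (List ℕ)) : Prop := ∀ r ∈ T, r.Pairwise (· ≤ ·)

theorem RowsSorted.tableauInsert {T : List (List ℕ)} (hT : RowsSorted T) (x : ℕ) :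
    RowsSorted (tableauInsert x T) := by
  induction T generalizing x with
  | nil => intro r hr; simp [RookPlacement.tableauInsert] at hr; simp [hr]
  | cons r T ih =>
    have h1 := pairwise_rowInsert (x := x) (hT r (by simp))
    have h2 : RowsSorted T := fun s hs => hT s (by simp [hs])
    simp only [RookPlacement.tableauInsert]
    rcases hx : rowInsert x r with ⟨r', _ | y⟩ <;> rw [hx] at h1 <;> intro s hs <;>
      rcases List.mem_cons.1 hs with rfl | hs
    · exact h1
    · exact h2 s hs
    · exact h1
    · exact ih h2 y s hs

theorem RowsSorted.insertWord {T : List (List ℕ)} (hT : RowsSorted T) (w : List ℕ) :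
    RowsSorted (insertWord w T) := by
  induction w generalizing T with
  | nil => exact hT
  | cons x w ih => exact ih (hT.tableauInsert x)

/-- Two words are equivalent if their insertions into any tableau have the same result. -/
def WordEquiv (u v : List ℕ) : Prop := ∀ T, RowsSorted T → insertWord u T = insertWord v T

theorem WordEquiv.refl (u : List ℕ) : WordEquiv u u := fun _ _ => rfl

theorem WordEquiv.symm {u v : List ℕ} (h : WordEquiv u v) : WordEquiv v u :=
  fun T hT => (h T hT).symm

theorem WordEquiv.trans {u v w : List ℕ} (h : WordEquiv u v) (h' : WordEquiv v w) :
    WordEquiv u w := fun T hT => (h T hT).trans (h' T hT)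

theorem WordEquiv.append {u v u' v' : List ℕ} (h : WordEquiv u v) (h' : WordEquiv u' v') :
    WordEquiv (u ++ u') (v ++ v') := fun T hT => by
  rw [insertWord_append, insertWord_append, h T hT, h' _ (hT.insertWord v)]

theorem WordEquiv.cons (x : ℕ) {u v : List ℕ} (h : WordEquiv u v) :
    WordEquiv (x :: u) (x :: v) := (WordEquiv.refl [x]).append h

theorem KnuthPair.wordEquiv {u v : List ℕ} (h : KnuthPair u v) : WordEquiv u v := by
  intro T hT
  induction T generalizing u v with
  | nil =>
    rcases h with ⟨hxy, hyz⟩ | ⟨hxy, hyz⟩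
    · simp [insertWord, tableauInsert, rowInsert, hxy, Nat.not_lt.2 hyz,
        Nat.not_lt.2 (hxy.le.trans hyz)]
    · simp [insertWord, tableauInsert, rowInsert, hyz, hxy.trans_lt hyz, Nat.not_lt.2 hxy,
        Nat.not_lt.2 (hxy.trans hyz.le)]
  | cons r T ih =>
    have h2 : RowsSorted T := fun s hs => hT s (by simp [hs])
    obtain ⟨h3, h4⟩ := h.rowInsertWord (hT r (by simp))
    rw [insertWord_cons_row, insertWord_cons_row, h3]
    rcases h4 with h4 | h4
    · rw [h4]
    · rw [ih h4 h2]

theorem KnuthPair.wordEquiv_append {u v : List ℕ} (h : KnuthPair u v) (w : List ℕ) :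
    WordEquiv (u ++ w) (v ++ w) := h.wordEquiv.append (.refl w)

/-- A letter larger than those of a decreasing word moves to its right end, past all but the
first letter. -/
theorem wordEquiv_push_right {q y : ℕ} {B : List ℕ} (hB : (y :: B).Pairwise (· > ·))
    (hq : y ≤ q) : WordEquiv (y :: q :: B) (y :: B ++ [q]) := by
  induction B generalizing y with
  | nil => exact .refl _
  | cons c B ih =>
    rw [List.pairwise_cons] at hB
    have hc : c < y := hB.1 c (by simp)
    exact ((KnuthPair.low hc hq).wordEquiv_append B).trans
      ((ih hB.2 (hc.le.trans hq)).cons y)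

/-- Insertion of a letter into a decreasing word, from the left. -/
theorem wordEquiv_column {x q : ℕ} {A B : List ℕ} (h : (A ++ q :: B).Pairwise (· > ·))
    (hq : x ≤ q) (hB : ∀ c ∈ B, c < x) :
    WordEquiv (x :: (A ++ q :: B)) (A ++ x :: B ++ [q]) := by
  induction A with
  | nil =>
    have h' := List.pairwise_cons.1 h
    exact wordEquiv_push_right (List.pairwise_cons.2 ⟨hB, h'.2⟩) hq
  | cons c A ih =>
    have h' := List.pairwise_cons.1 h
    refine WordEquiv.trans ?_ ((ih h'.2).cons c)
    -- The letter x passes c with the letter after c as witness: q, or the next letter d of A.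
    rcases A with _ | ⟨d, A⟩
    · exact (KnuthPair.high hq (h'.1 q (by simp))).wordEquiv_append B
    · have hqd : q < d := (List.pairwise_cons.1 h'.2).1 q (by simp)
      exact (KnuthPair.high (hq.trans hqd.le) (h'.1 d (by simp))).wordEquiv_append _

/-! ### Column insertion -/

/-- A column of a tableau read from its smallest entry; `⊤` marks an empty slot. -/
abbrev Col := ℕ → WithTop ℕ

/-- A column is strictly increasing up to its end. -/
structure IsCol (C : Col) : Prop where
  lt_or_top : ∀ i j, i < j → C i < C j ∨ C j = ⊤
  finite : ∃ i, C i = ⊤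

/-- The slot of the column `C` where the letter `x` is put: the first entry `≥ x`. -/
noncomputable def landing (x : WithTop ℕ) (C : Col) : ℕ := sInf {i | x ≤ C i}

/-- The column after the insertion of `x`. -/
noncomputable def colPut (x : WithTop ℕ) (C : Col) : Col := Function.update C (landing x C) x

/-- The letter bumped by the insertion of `x`. -/
noncomputable def colBump (x : WithTop ℕ) (C : Col) : WithTop ℕ := C (landing x C)

theorem IsCol.le {C : Col} (hC : IsCol C) {i j : ℕ} (h : i ≤ j) : C i ≤ C j := by
  rcases h.eq_or_lt with rfl | h
  · exact le_rfl
  · rcases hC.lt_or_top i j h with h | h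
    · exact h.le
    · simp [h]

theorem IsCol.le_landing {C : Col} (hC : IsCol C) (x : WithTop ℕ) : x ≤ C (landing x C) := by
  obtain ⟨i, hi⟩ := hC.finite
  exact Nat.sInf_mem (s := {i | x ≤ C i}) ⟨i, by simp [hi]⟩

theorem lt_of_lt_landing {C : Col} {x : WithTop ℕ} {i : ℕ} (h : i < landing x C) : C i < x := by
  have := Nat.notMem_of_lt_sInf h
  simpa using this

theorem landing_le {C : Col} {x : WithTop ℕ} {i : ℕ} (h : x ≤ C i) : landing x C ≤ i :=
  Nat.sInf_le h

theorem landing_eq {C : Col} {x : WithTop ℕ} {t : ℕ} (h : ∀ i < t, C i < x) (h' : x ≤ C t) :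
    landing x C = t := by
  refine le_antisymm (landing_le h') ?_
  by_contra! hlt
  exact absurd (h _ hlt) (not_lt.2 (Nat.sInf_mem (s := {i | x ≤ C i}) ⟨t, h'⟩))

theorem IsCol.colPut {C : Col} (hC : IsCol C) (x : WithTop ℕ) : IsCol (colPut x C) := by
  have h1 := hC.le_landing x
  refine ⟨fun i j hij => ?_, ?_⟩
  · simp only [RookPlacement.colPut, Function.update_apply]
    split_ifs with hi hj hj
    · omega
    · rcases hC.lt_or_top i j hij with h | h
      · left; rw [hi] at h; exact h1.trans_lt h
      · exact .inr h
    · exact .inl (lt_of_lt_landing (hj ▸ hij))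
    · exact hC.lt_or_top i j hij
  · obtain ⟨i, hi⟩ := hC.finite
    refine ⟨max i (landing x C) + 1, ?_⟩
    rw [RookPlacement.colPut, Function.update_of_ne (by omega)]
    exact top_le_iff.1 (hi ▸ hC.le (by omega))

/-- A tableau, given as the sequence of its columns. -/
structure IsTab (T : ℕ → Col) : Prop where
  isCol : ∀ j, IsCol (T j)
  le : ∀ j i, T j i ≤ T (j + 1) i

/-- The letters bumped from column to column by the insertion of `x`. -/
noncomputable def bumpSeq (x : WithTop ℕ) (T : ℕ → Col) : ℕ → WithTop ℕ
  | 0 => x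
  | j + 1 => colBump (bumpSeq x T j) (T j)

/-- Column insertion of `x` into the tableau `T`. -/
noncomputable def tabInsert (x : WithTop ℕ) (T : ℕ → Col) : ℕ → Col :=
  fun j => colPut (bumpSeq x T j) (T j)

/-- A tableau without its first column. -/
def tabTail (T : ℕ → Col) : ℕ → Col := fun j => T (j + 1)

theorem tabTail_tabInsert (x : WithTop ℕ) (T : ℕ → Col) :
    tabTail (tabInsert x T) = tabInsert (colBump x (T 0)) (tabTail T) := by
  have key : ∀ j, bumpSeq x T (j + 1) = bumpSeq (colBump x (T 0)) (tabTail T) j := by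
    intro j
    induction j with
    | zero => rfl
    | succ j ih => rw [bumpSeq, ih]; rfl
  funext j
  simp only [tabTail, tabInsert, key]

theorem IsTab.tabTail {T : ℕ → Col} (hT : IsTab T) : IsTab (tabTail T) :=
  ⟨fun j => hT.isCol (j + 1), fun j => hT.le (j + 1)⟩

/-- A letter bumped from slot t lands in slot t or an earlier one of the next column, because the
entry in slot t there is at least as large. -/
theorem IsTab.tabInsert {T : ℕ → Col} (hT : IsTab T) (x : WithTop ℕ) :
    IsTab (tabInsert x T) := by
  refine ⟨fun j => (hT.isCol j).colPut _, fun j i => ?_⟩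
  set y := bumpSeq x T j with hy
  set t := landing y (T j) with ht
  have hb : bumpSeq x T (j + 1) = T j t := rfl
  have h1 : landing (T j t) (T (j + 1)) ≤ t := landing_le (hT.le j t)
  have h2 : y ≤ T j t := (hT.isCol j).le_landing y
  simp only [RookPlacement.tabInsert, colPut, hb, ← hy, ← ht, Function.update_apply]
  split_ifs with h3 h4 h4
  · exact h2
  · rw [h3]; exact h2.trans (hT.le j t)
  · exact (hT.isCol j).le (h4 ▸ h1)
  · exact hT.le j i

theorem IsCol.colPut_top {C : Col} (hC : IsCol C) : RookPlacement.colPut ⊤ C = C := by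
  have := hC.le_landing ⊤
  rw [RookPlacement.colPut, Function.update_eq_self_iff]
  exact (top_le_iff.1 this).symm

theorem IsCol.colBump_top {C : Col} (hC : IsCol C) : colBump ⊤ C = ⊤ :=
  top_le_iff.1 (hC.le_landing ⊤)

/-- Thus `⊤` serves as the absent letter, and a bumping sequence never has to stop. -/
theorem IsTab.tabInsert_top {T : ℕ → Col} (hT : IsTab T) :
    RookPlacement.tabInsert ⊤ T = T := by
  have key : ∀ j, bumpSeq ⊤ T j = ⊤ := by
    intro j
    induction j with
    | zero => rfl
    | succ j ih => rw [bumpSeq, ih, (hT.isCol j).colBump_top]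
  funext j
  rw [RookPlacement.tabInsert, key, (hT.isCol j).colPut_top]

/-! ### Slides and their compatibility with column insertion -/

/-- `Slide n m T T'`: in its first `n` columns `T'` arises from `T` by deleting the entry of the
first column in slot `m` and sliding along a path that leaves the first column in slot `m'`. -/
def Slide : ℕ → ℕ → (ℕ → Col) → (ℕ → Col) → Prop
  | 0, _, _, _ => True
  | n + 1, m, T, T' => ∃ m', m ≤ m' ∧ (∀ i < m, T' 0 i = T 0 i) ∧
      (∀ i, m ≤ i → i < m' → T' 0 i = T 0 (i + 1)) ∧ (∀ i, m' < i → T' 0 i = T 0 i) ∧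
      T' 0 m' = T 1 m' ∧ Slide n m' (tabTail T) (tabTail T')

theorem Slide.refl {T : ℕ → Col} (hT : IsTab T) {m : ℕ} (h : T 0 m = ⊤) (n : ℕ) :
    Slide n m T T := by
  induction n generalizing T with
  | zero => trivial
  | succ n ih =>
    have h1 : T 1 m = ⊤ := top_le_iff.1 (h ▸ hT.le 0 m)
    exact ⟨m, le_rfl, fun _ _ => rfl, by omega, fun _ _ => rfl, by rw [h, h1], ih hT.tabTail h1⟩

/-- A slide that starts in an empty slot only moves through empty slots. -/
theorem Slide.eq_of_top {T T' : ℕ → Col} (hT : IsTab T) {m n : ℕ} (h : T 0 m = ⊤)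
    (hs : Slide n m T T') {j : ℕ} (hj : j < n) : T' j = T j := by
  induction n generalizing T T' m j with
  | zero => omega
  | succ n ih =>
    obtain ⟨m', hm, h1, h2, h3, h4, h5⟩ := hs
    have htop : ∀ i, m ≤ i → T 0 i = ⊤ := fun i hi =>
      top_le_iff.1 (h ▸ (hT.isCol 0).le hi)
    have h6 : T 1 m' = ⊤ := top_le_iff.1 (htop m' hm ▸ hT.le 0 m')
    rcases j with _ | j
    · funext i
      rcases lt_or_ge i m with hi | hi
      · exact h1 i hi
      · rcases lt_trichotomy i m' with hi' | rfl | hi'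
        · rw [h2 i hi hi', htop i hi, htop _ (by omega)]
        · rw [h4, h6, htop _ hi]
        · exact h3 i hi'
    · exact ih hT.tabTail h6 h5 (by omega)

theorem Slide.congr_right {T T' T'' : ℕ → Col} {n m : ℕ} (hs : Slide n m T T')
    (h : ∀ j < n, T' j = T'' j) : Slide n m T T'' := by
  induction n generalizing T T' T'' m with
  | zero => trivial
  | succ n ih =>
    obtain ⟨m', hm, h1, h2, h3, h4, h5⟩ := hs
    rw [h 0 (by omega)] at h1 h2 h3 h4
    exact ⟨m', hm, h1, h2, h3, h4, ih h5 fun j hj => h (j + 1) (by omega)⟩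

/-- The insertion pushes the entries in slot 0 one column to the right; the slide pulls them back.
-/
theorem slide_tabInsert_self {T : ℕ → Col} (hT : IsTab T) {s : WithTop ℕ} (hs : s ≤ T 0 0)
    (n : ℕ) : Slide n 0 (tabInsert s T) T := by
  induction n generalizing T s with
  | zero => trivial
  | succ n ih =>
    have h0 : landing s (T 0) = 0 := Nat.le_zero.1 (landing_le hs)
    have hb : colBump s (T 0) = T 0 0 := by rw [colBump, h0]
    have h1 : T 0 0 ≤ T 1 0 := hT.le 0 0
    refine ⟨0, le_rfl, by simp, by simp, fun i hi => ?_, ?_, ?_⟩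
    · simp only [tabInsert, colPut, bumpSeq, h0]
      rw [Function.update_of_ne (by omega)]
    · simp only [tabInsert, bumpSeq, hb, colPut, Nat.le_zero.1 (landing_le h1),
        Function.update_self]
    · rw [tabTail_tabInsert, hb]
      exact ih hT.tabTail h1

/-- In the second statement the deleted entry returns to T' while z, put only into T, becomes the
deleted one. Both are needed at once: in the next column either the same letter is inserted on both
sides, away from the hole m', or T' has bumped T 1 m', the entry deleted there, and the second
statement applies. One column is lost in the count, since a slide looks one column ahead. -/
theorem slide_tabInsert_aux (n : ℕ) : ∀ {T T' : ℕ → Col}, IsTab T → IsTab T' → ∀ {m : ℕ},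
    Slide (n + 1) m T T' →
    (∀ y, landing y (T 0) ≠ m → Slide n m (tabInsert y T) (tabInsert y T')) ∧
    (∀ z, T 0 m < z → z ≤ T 0 (m + 1) →
      Slide n (m + 1) (tabInsert z T) (tabInsert (T 0 m) T')) := by
  induction n with
  | zero => intros; exact ⟨fun _ _ => trivial, fun _ _ _ => trivial⟩
  | succ n ih =>
    intro T T' hT hT' m hs
    obtain ⟨m', hm, h1, h2, h3, h4, h5⟩ := hs
    obtain ⟨ihY, ihS⟩ := ih hT.tabTail hT'.tabTail h5
    have hC := hT.isCol 0
    have hC' := hT'.isCol 0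
    -- below slot `m'` the second columns agree
    have hD : ∀ i < m', T' 1 i = T 1 i := by
      obtain ⟨m'', -, h, -⟩ := h5
      exact h
    -- the first columns, for letters bumped by both insertions
    have common : ∀ (q : WithTop ℕ), landing q (T 1) ≠ m' →
        T' 0 m' = tabInsert q (tabTail T) 0 m' ∧
          Slide n m' (tabInsert q (tabTail T)) (tabInsert q (tabTail T')) := by
      intro q hq
      refine ⟨?_, ihY q hq⟩
      simp only [tabInsert, bumpSeq, tabTail, colPut]
      rw [Function.update_of_ne (Ne.symm hq), h4]
    -- the first columns, when the slide moves down one more slot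
    have down : T' 0 m' ≤ T 0 (m' + 1) ∧ T 0 (m' + 1) = tabInsert (T 0 (m' + 1)) (tabTail T) 0 (m' + 1) ∧
          Slide n (m' + 1) (tabInsert (T 0 (m' + 1)) (tabTail T))
            (tabInsert (T' 0 m') (tabTail T')) := by
      have hq : T 0 (m' + 1) ≤ T 1 (m' + 1) := hT.le 0 (m' + 1)
      have ho := hC'.lt_or_top m' (m' + 1) (by omega)
      rw [h3 (m' + 1) (by omega)] at ho
      refine ⟨by rcases ho with h | h; exacts [h.le, h ▸ le_top], ?_⟩
      -- Without strict inequality both entries are `⊤`, and nothing is inserted into the next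
      -- column.
      by_cases hlt : T' 0 m' < T 0 (m' + 1)
      · constructor
        · simp only [tabInsert, bumpSeq, tabTail, colPut]
          rw [landing_eq (t := m' + 1) _ hq, Function.update_self]
          intro i hi
          exact ((hT.isCol 1).le (Nat.le_of_lt_succ hi)).trans_lt (h4 ▸ hlt)
        · rw [h4] at hlt ⊢
          exact ihS _ hlt hq
      · have htop : T 0 (m' + 1) = ⊤ := by tauto
        have htop' : T' 0 m' = ⊤ := top_le_iff.1 (htop ▸ not_lt.1 hlt)
        have htop1 : T 1 (m' + 1) = ⊤ := top_le_iff.1 (htop ▸ hq)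
        rw [htop, htop', hT.tabTail.tabInsert_top, hT'.tabTail.tabInsert_top]
        have hT1 : T 1 m' = ⊤ := by rw [← h4, htop']
        exact ⟨htop1.symm, (Slide.refl hT.tabTail htop1 n).congr_right fun j hj =>
          (Slide.eq_of_top hT.tabTail hT1 h5 (by omega)).symm⟩
    constructor
    · intro y hy
      obtain ⟨t, ht⟩ : ∃ t, t = landing y (T 0) := ⟨_, rfl⟩
      rw [← ht] at hy
      have hyt : y ≤ T 0 t := ht ▸ hC.le_landing y
      have hty : ∀ i < t, T 0 i < y := fun i hi => lt_of_lt_landing (ht ▸ hi)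
      have hby : colBump y (T 0) = T 0 t := by rw [colBump, ht]
      rcases lt_or_gt_of_ne hy with htm | htm
      · -- `y` lands below the slot `m`
        have ht' : landing y (T' 0) = t :=
          landing_eq (fun i hi => h1 i (hi.trans htm) ▸ hty i hi) (h1 t htm ▸ hyt)
        have hby' : colBump y (T' 0) = T 0 t := by rw [colBump, ht', h1 t htm]
        have hland : landing (T 0 t) (T 1) ≤ t := landing_le (hT.le 0 t)
        obtain ⟨c1, c2⟩ := common (T 0 t) (by omega)
        refine ⟨m', hm, fun i hi => ?_, fun i hi hi' => ?_, fun i hi => ?_, ?_, ?_⟩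
        · simp only [tabInsert, bumpSeq, colPut, ← ht, ht', Function.update_apply, h1 i hi]
        · simp only [tabInsert, bumpSeq, colPut, ← ht, ht']
          rw [Function.update_of_ne (by omega), Function.update_of_ne (by omega), h2 i hi hi']
        · simp only [tabInsert, bumpSeq, colPut, ← ht, ht']
          rw [Function.update_of_ne (by omega), Function.update_of_ne (by omega), h3 i hi]
        · change _ = tabTail (tabInsert y T) 0 m'
          rw [tabTail_tabInsert, hby, ← c1]
          simp only [tabInsert, bumpSeq, colPut, ht']
          rw [Function.update_of_ne (by omega)]
        · rw [tabTail_tabInsert, tabTail_tabInsert, hby, hby']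
          exact c2
      · by_cases htm' : t ≤ m'
        · -- `y` lands on the part of the column that slides down
          obtain ⟨u, rfl⟩ : ∃ u, t = u + 1 := ⟨t - 1, by omega⟩
          have hu : T' 0 u = T 0 (u + 1) := h2 u (by omega) (by omega)
          have ht' : landing y (T' 0) = u := by
            refine landing_eq (fun i hi => ?_) (hu ▸ hyt)
            rcases lt_or_ge i m with him | him
            · exact h1 i him ▸ hty i (by omega)
            · exact h2 i him (by omega) ▸ hty (i + 1) (by omega)
          have hby' : colBump y (T' 0) = T 0 (u + 1) := by rw [colBump, ht', hu]
          -- The bumped letter is also T' 0 u, so it is at most T' 1 u = T 1 u.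
          have hland : landing (T 0 (u + 1)) (T 1) ≤ u :=
            landing_le (by rw [← hD u (by omega), ← hu]; exact hT'.le 0 u)
          obtain ⟨c1, c2⟩ := common (T 0 (u + 1)) (by omega)
          refine ⟨m', hm, fun i hi => ?_, fun i hi hi' => ?_, fun i hi => ?_, ?_, ?_⟩
          · simp only [tabInsert, bumpSeq, colPut, ← ht, ht']
            rw [Function.update_of_ne (by omega), Function.update_of_ne (by omega), h1 i hi]
          · simp only [tabInsert, bumpSeq, colPut, ← ht, ht', Function.update_apply,
              h2 i hi hi', Nat.add_right_cancel_iff]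
          · simp only [tabInsert, bumpSeq, colPut, ← ht, ht']
            rw [Function.update_of_ne (by omega), Function.update_of_ne (by omega), h3 i hi]
          · change _ = tabTail (tabInsert y T) 0 m'
            rw [tabTail_tabInsert, hby, ← c1]
            simp only [tabInsert, bumpSeq, colPut, ht']
            rw [Function.update_of_ne (by omega)]
          · rw [tabTail_tabInsert, tabTail_tabInsert, hby, hby']
            exact c2
        · have hlow : ∀ i < m', T' 0 i < y := by
            intro i hi
            rcases lt_or_ge i m with him | him
            · exact h1 i him ▸ hty i (by omega)
            · exact h2 i him (by omega) ▸ hty (i + 1) (by omega)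
          by_cases hyo : y ≤ T' 0 m'
          · -- the slide is moved down by one slot
            have ht' : landing y (T' 0) = m' := landing_eq hlow hyo
            have htm1 : t = m' + 1 := by
              by_contra hne
              have h6 := hty (m' + 1) (by omega)
              exact absurd (hyo.trans down.1) (not_le.2 h6)
            have hby' : colBump y (T' 0) = T' 0 m' := by rw [colBump, ht']
            obtain ⟨-, c1, c2⟩ := down
            rw [htm1] at ht hby
            refine ⟨m' + 1, by omega, fun i hi => ?_, fun i hi hi' => ?_, fun i hi => ?_, ?_, ?_⟩
            · simp only [tabInsert, bumpSeq, colPut, ← ht, ht']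
              rw [Function.update_of_ne (by omega), Function.update_of_ne (by omega), h1 i hi]
            · simp only [tabInsert, bumpSeq, colPut, ← ht, ht', Function.update_apply,
                Nat.add_right_cancel_iff]
              split_ifs with him
              · rfl
              · exact h2 i hi (by omega)
            · simp only [tabInsert, bumpSeq, colPut, ← ht, ht']
              rw [Function.update_of_ne (by omega), Function.update_of_ne (by omega),
                h3 i (by omega)]
            · change _ = tabTail (tabInsert y T) 0 (m' + 1)
              rw [tabTail_tabInsert, hby, ← c1]
              simp only [tabInsert, bumpSeq, colPut, ht']
              rw [Function.update_of_ne (by omega), h3 _ (by omega)]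
            · rw [tabTail_tabInsert, tabTail_tabInsert, hby, hby']
              exact c2
          · -- `y` lands above the slide
            rw [not_le] at hyo
            have ht' : landing y (T' 0) = t := by
              refine landing_eq (fun i hi => ?_) (h3 t (by omega) ▸ hyt)
              rcases lt_trichotomy i m' with him | rfl | him
              · exact hlow i him
              · exact hyo
              · exact h3 i him ▸ hty i hi
            have hby' : colBump y (T' 0) = T 0 t := by rw [colBump, ht', h3 t (by omega)]
            -- The bumped letter is at least y, which exceeds T 1 m'.
            have hland : landing (T 0 t) (T 1) ≠ m' := by
              intro h6
              have h7 := (hT.isCol 1).le_landing (T 0 t)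
              rw [h6, ← h4] at h7
              exact absurd (hyt.trans h7) (not_le.2 hyo)
            obtain ⟨c1, c2⟩ := common (T 0 t) hland
            refine ⟨m', hm, fun i hi => ?_, fun i hi hi' => ?_, fun i hi => ?_, ?_, ?_⟩
            · simp only [tabInsert, bumpSeq, colPut, ← ht, ht']
              rw [Function.update_of_ne (by omega), Function.update_of_ne (by omega), h1 i hi]
            · simp only [tabInsert, bumpSeq, colPut, ← ht, ht']
              rw [Function.update_of_ne (by omega), Function.update_of_ne (by omega), h2 i hi hi']
            · simp only [tabInsert, bumpSeq, colPut, ← ht, ht', Function.update_apply, h3 i hi]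
            · change _ = tabTail (tabInsert y T) 0 m'
              rw [tabTail_tabInsert, hby, ← c1]
              simp only [tabInsert, bumpSeq, colPut, ht']
              rw [Function.update_of_ne (by omega)]
            · rw [tabTail_tabInsert, tabTail_tabInsert, hby, hby']
              exact c2
    · intro z hz hz'
      have ht : landing z (T 0) = m + 1 :=
        landing_eq (fun i hi => (hC.le (Nat.le_of_lt_succ hi)).trans_lt hz) hz'
      have hbz : colBump z (T 0) = T 0 (m + 1) := by rw [colBump, ht]
      have hlow : ∀ i < m, T' 0 i < T 0 m := by
        intro i hi
        rw [h1 i hi]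
        rcases hC.lt_or_top i m hi with h | h
        · exact h
        · simp [h] at hz
      rcases hm.eq_or_lt with rfl | hmm
      · -- the slide is moved down by one slot
        have ht' : landing (T 0 m) (T' 0) = m := landing_eq hlow (h4 ▸ hT.le 0 m)
        have hbz' : colBump (T 0 m) (T' 0) = T' 0 m := by rw [colBump, ht']
        obtain ⟨-, c1, c2⟩ := down
        refine ⟨m + 1, le_rfl, fun i hi => ?_, by omega, fun i hi => ?_, ?_, ?_⟩
        · simp only [tabInsert, bumpSeq, colPut, ht, ht', Function.update_apply]
          rw [if_neg (show i ≠ m + 1 by omega)]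
          split_ifs with him
          · rw [him]
          · exact h1 i (by omega)
        · simp only [tabInsert, bumpSeq, colPut, ht, ht']
          rw [Function.update_of_ne (by omega), Function.update_of_ne (by omega),
            h3 i (by omega)]
        · change _ = tabTail (tabInsert z T) 0 (m + 1)
          rw [tabTail_tabInsert, hbz, ← c1]
          simp only [tabInsert, bumpSeq, colPut, ht']
          rw [Function.update_of_ne (by omega), h3 _ (by omega)]
        · rw [tabTail_tabInsert, tabTail_tabInsert, hbz, hbz']
          exact c2
      · have hm1 : T' 0 m = T 0 (m + 1) := h2 m le_rfl hmm
        have ht' : landing (T 0 m) (T' 0) = m :=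
          landing_eq hlow (hm1 ▸ hC.le (Nat.le_succ m))
        have hbz' : colBump (T 0 m) (T' 0) = T 0 (m + 1) := by rw [colBump, ht', hm1]
        have hland : landing (T 0 (m + 1)) (T 1) ≤ m :=
          landing_le (by rw [← hD m hmm, ← hm1]; exact hT'.le 0 m)
        obtain ⟨c1, c2⟩ := common (T 0 (m + 1)) (by omega)
        refine ⟨m', hmm, fun i hi => ?_, fun i hi hi' => ?_, fun i hi => ?_, ?_, ?_⟩
        · simp only [tabInsert, bumpSeq, colPut, ht, ht', Function.update_apply]
          rw [if_neg (show i ≠ m + 1 by omega)]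
          split_ifs with him
          · rw [him]
          · exact h1 i (by omega)
        · simp only [tabInsert, bumpSeq, colPut, ht, ht']
          rw [Function.update_of_ne (by omega), Function.update_of_ne (by omega),
            h2 i (by omega) hi']
        · simp only [tabInsert, bumpSeq, colPut, ht, ht']
          rw [Function.update_of_ne (by omega), Function.update_of_ne (by omega), h3 i hi]
        · change _ = tabTail (tabInsert z T) 0 m'
          rw [tabTail_tabInsert, hbz, ← c1]
          simp only [tabInsert, bumpSeq, colPut, ht']
          rw [Function.update_of_ne (by omega)]
        · rw [tabTail_tabInsert, tabTail_tabInsert, hbz, hbz']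
          exact c2

theorem Slide.tabInsert_of_ne {T T' : ℕ → Col} (hT : IsTab T) (hT' : IsTab T') {m : ℕ}
    (hs : ∀ n, Slide n m T T') {y : WithTop ℕ} (hy : landing y (T 0) ≠ m) (n : ℕ) :
    Slide n m (tabInsert y T) (tabInsert y T') :=
  (slide_tabInsert_aux n hT hT' (hs (n + 1))).1 y hy

theorem Slide.tabInsert_succ {T T' : ℕ → Col} (hT : IsTab T) (hT' : IsTab T') {m : ℕ}
    (hs : ∀ n, Slide n m T T') {z : WithTop ℕ} (hz : T 0 m < z) (hz' : z ≤ T 0 (m + 1)) (n : ℕ) :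
    Slide n (m + 1) (tabInsert z T) (tabInsert (T 0 m) T') :=
  (slide_tabInsert_aux n hT hT' (hs (n + 1))).2 z hz hz'

/-! ### Recovering a word, up to equivalence, from its column insertion tableau -/

/-- The word of length at most one consisting of `x`, if `x ≠ ⊤`. -/
def letterWord (x : WithTop ℕ) : List ℕ := if x = ⊤ then [] else [x.untopD 0]

/-- The column insertion tableau of a word, whose letters are inserted from right to left. -/
noncomputable def colTab : List ℕ → ℕ → Col
  | [] => fun _ _ => ⊤
  | x :: w => tabInsert (WithTop.some x) (colTab w)

/-- The word of the letters bumped from the first column by the column insertion of a word. -/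
noncomputable def bumpedWord : List ℕ → List ℕ
  | [] => []
  | x :: w => letterWord (colBump (WithTop.some x) (colTab w 0)) ++ bumpedWord w

theorem isTab_colTab (w : List ℕ) : IsTab (colTab w) := by
  induction w with
  | nil => exact ⟨fun _ => ⟨fun _ _ _ => .inr rfl, 0, rfl⟩, fun _ _ => le_rfl⟩
  | cons x w ih => exact ih.tabInsert _

theorem tabTail_colTab (w : List ℕ) : tabTail (colTab w) = colTab (bumpedWord w) := by
  induction w with
  | nil => rfl
  | cons x w ih =>
    rw [colTab, tabTail_tabInsert, bumpedWord, letterWord, ih]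
    split_ifs with h
    · rw [h, (isTab_colTab _).tabInsert_top, List.nil_append]
    · obtain ⟨q, hq⟩ := WithTop.ne_top_iff_exists.1 h
      rw [← hq]
      rfl

/-- The rightmost letter enters an empty column and bumps nothing. Hence induction on the length is
possible. -/
theorem length_bumpedWord (w : List ℕ) : (bumpedWord w).length ≤ w.length - 1 := by
  have h1 : ∀ x : WithTop ℕ, (letterWord x).length ≤ 1 := by
    intro x
    unfold letterWord
    split_ifs <;> simp
  induction w with
  | nil => simp [bumpedWord]
  | cons x w ih =>
    rcases w with _ | ⟨y, w⟩
    · simp [bumpedWord, colBump, colTab, letterWord]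
    · have := h1 (colBump (WithTop.some x) (colTab (y :: w) 0))
      rw [bumpedWord, List.length_append]
      simp only [List.length_cons] at ih ⊢
      omega

/-- The entries of a column in decreasing order. -/
noncomputable def colWord (C : Col) : List ℕ :=
  ((List.range (landing ⊤ C)).map fun i => (C i).untopD 0).reverse

/-- If x exceeds all entries, it just extends the decreasing word; otherwise this is
`wordEquiv_column`. -/
theorem IsCol.wordEquiv_colPut {C : Col} (hC : IsCol C) (x : ℕ) :
    WordEquiv (x :: colWord C)
      (colWord (RookPlacement.colPut (WithTop.some x) C) ++
        letterWord (colBump (WithTop.some x) C)) := by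
  obtain ⟨t, ht⟩ : ∃ t, t = landing (WithTop.some x) C := ⟨_, rfl⟩
  obtain ⟨l, hl⟩ : ∃ l, l = landing ⊤ C := ⟨_, rfl⟩
  have hxt : WithTop.some x ≤ C t := ht ▸ hC.le_landing x
  have htx : ∀ i < t, C i < WithTop.some x := fun i hi => lt_of_lt_landing (ht ▸ hi)
  have hlt : ∀ i < l, C i < ⊤ := fun i hi => lt_of_lt_landing (hl ▸ hi)
  have hltop : C l = ⊤ := top_le_iff.1 (hl ▸ hC.le_landing ⊤)
  have htl : t ≤ l := ht ▸ landing_le (by simp [hltop])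
  have hput : ∀ i, RookPlacement.colPut (WithTop.some x) C i = if i = t then WithTop.some x else C i := by
    intro i
    rw [RookPlacement.colPut, ← ht, Function.update_apply]
  have hlow : ∀ s ≤ t, (List.range s).map (fun i => (RookPlacement.colPut (WithTop.some x) C i).untopD 0) =
      (List.range s).map (fun i => (C i).untopD 0) := by
    intro s hs
    refine List.map_congr_left fun i hi => ?_
    rw [List.mem_range] at hi
    rw [hput, if_neg (by omega)]
  rw [colBump, ← ht, colWord, colWord, ← hl]
  rcases htl.eq_or_lt with rfl | htl
  · have hl' : landing ⊤ (RookPlacement.colPut (WithTop.some x) C) = t + 1 := by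
      refine landing_eq (fun i hi => ?_) ?_
      · rw [hput]
        split_ifs with h
        · exact WithTop.coe_lt_top x
        · exact hlt i (by omega)
      · rw [hput, if_neg (by omega)]
        exact hltop ▸ hC.le (Nat.le_succ t)
    rw [hl', hltop, letterWord, if_pos rfl, List.append_nil, List.range_succ, List.map_append,
      List.reverse_append, hlow t le_rfl]
    simp only [List.map_cons, List.map_nil, List.reverse_singleton, hput, if_true]
    exact .refl _
  · have hl' : landing ⊤ (RookPlacement.colPut (WithTop.some x) C) = l := by
      refine landing_eq (fun i hi => ?_) ?_
      · rw [hput]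
        split_ifs with h
        · exact WithTop.coe_lt_top x
        · exact hlt i hi
      · rw [hput, if_neg (by omega), hltop]
    have hlt' : ∀ i < l, WithTop.some ((C i).untopD 0) = C i := by
      intro i hi
      obtain ⟨c, hc⟩ := WithTop.ne_top_iff_exists.1 (hlt i hi).ne
      rw [← hc]; rfl
    have hsort : ((List.range l).map fun i => (C i).untopD 0).reverse.Pairwise (· > ·) := by
      rw [List.pairwise_reverse, List.pairwise_map]
      refine List.Pairwise.imp_of_mem ?_ List.pairwise_lt_range
      intro i j hi hj hij
      rw [List.mem_range] at hi hj
      rw [gt_iff_lt, ← WithTop.coe_lt_coe, hlt' i hi, hlt' j hj]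
      rcases hC.lt_or_top i j hij with h | h
      · exact h
      · exact absurd h (hlt j hj).ne
    -- The range is split at the landing slot t; after reversal the d slots beyond t form the word A
    -- of `wordEquiv_column`.
    obtain ⟨d, rfl⟩ : ∃ d, l = t + (1 + d) := ⟨l - t - 1, by omega⟩
    have hrange : List.range (t + (1 + d)) =
        List.range t ++ (t :: List.range' (t + 1) d) := by
      rw [List.range_add, List.range_eq_range' (n := 1 + d), List.map_add_range', add_comm 1 d]
      rfl
    have hhigh : (List.range' (t + 1) d).map (fun i => (RookPlacement.colPut (WithTop.some x) C i).untopD 0) =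
      (List.range' (t + 1) d).map (fun i => (C i).untopD 0) := by
      refine List.map_congr_left fun i hi => ?_
      have := (List.mem_range'_1.1 hi).1
      rw [hput, if_neg (by omega)]
    rw [hl', letterWord, if_neg (hlt t htl).ne]
    rw [hrange] at hsort ⊢
    simp only [List.map_append, List.map_cons, List.reverse_append, List.reverse_cons,
      hlow t le_rfl, hhigh, List.append_assoc, List.singleton_append] at hsort ⊢
    rw [hput, if_pos rfl, WithTop.untopD_coe]
    have h1 : x ≤ (C t).untopD 0 := by
      rw [← WithTop.coe_le_coe, hlt' t htl]
      exact hxt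
    have h2 : ∀ c ∈ ((List.range t).map fun i => (C i).untopD 0).reverse, c < x := by
      intro c hc
      simp only [List.mem_reverse, List.mem_map, List.mem_range] at hc
      obtain ⟨i, hi, rfl⟩ := hc
      rw [← WithTop.coe_lt_coe, hlt' i (by omega)]
      exact htx i hi
    simpa using wordEquiv_column hsort h1 h2

theorem wordEquiv_colWord_append_bumpedWord (w : List ℕ) :
    WordEquiv w (colWord (colTab w 0) ++ bumpedWord w) := by
  induction w with
  | nil =>
    have : landing ⊤ (colTab [] 0) = 0 := landing_eq (by simp) le_rfl
    rw [colWord, this]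
    exact .refl _
  | cons x w ih =>
    refine (ih.cons x).trans ?_
    rw [bumpedWord, ← List.append_assoc, ← List.cons_append]
    exact (((isTab_colTab w).isCol 0).wordEquiv_colPut x).append (.refl _)

/-- Words with the same column insertion tableau are equivalent. -/
theorem wordEquiv_of_colTab_eq {u v : List ℕ} (h : colTab u = colTab v) : WordEquiv u v := by
  obtain ⟨n, hu, hv⟩ : ∃ n, u.length ≤ n ∧ v.length ≤ n := ⟨_, le_max_left _ _, le_max_right _ _⟩
  induction n generalizing u v with
  | zero =>
    rw [List.length_eq_zero_iff.1 (Nat.le_zero.1 hu), List.length_eq_zero_iff.1 (Nat.le_zero.1 hv)]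
    exact .refl _
  | succ n ih =>
    have hu' := length_bumpedWord u
    have hv' := length_bumpedWord v
    refine (wordEquiv_colWord_append_bumpedWord u).trans
      (.trans ?_ (wordEquiv_colWord_append_bumpedWord v).symm)
    -- Equal tableaux have equal first columns, and their tails are the tableaux of the bumped
    -- words.
    rw [h]
    exact (WordEquiv.refl _).append
      (ih (by rw [← tabTail_colTab, ← tabTail_colTab, h]) (by omega) (by omega))

/-! ### Decreasing subsequences and the first column -/

/-- A letter that lands in slot `t` is the first letter of a decreasing sequence of length
`t + 1`. -/
theorem exists_decreasing_of_landing {w : List ℕ}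
    (hw : ∀ (j c : ℕ), colTab w 0 j = WithTop.some c →
      ∃ d, (c :: d).Sublist w ∧ (c :: d).Pairwise (· > ·) ∧ d.length = j) (x : ℕ) :
    ∃ d, d.Sublist w ∧ (x :: d).Pairwise (· > ·) ∧ d.length = landing (WithTop.some x) (colTab w 0) := by
  rcases ht : landing (WithTop.some x) (colTab w 0) with _ | t
  · exact ⟨[], by simp⟩
  · have h1 : colTab w 0 t < WithTop.some x := lt_of_lt_landing (by omega)
    obtain ⟨c, hc⟩ := WithTop.ne_top_iff_exists.1 (h1.trans (WithTop.coe_lt_top x)).ne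
    obtain ⟨d, hd, hp, hl⟩ := hw t c hc.symm
    rw [← hc, WithTop.coe_lt_coe] at h1
    refine ⟨c :: d, hd, List.pairwise_cons.2 ⟨fun e he => ?_, hp⟩, by simp [hl]⟩
    rcases List.mem_cons.1 he with rfl | he
    · exact h1
    · exact ((List.pairwise_cons.1 hp).1 e he).trans h1

theorem exists_decreasing_of_colTab {w : List ℕ} {j c : ℕ} (h : colTab w 0 j = WithTop.some c) :
    ∃ d, (c :: d).Sublist w ∧ (c :: d).Pairwise (· > ·) ∧ d.length = j := by
  induction w generalizing j c with
  | nil => simp [colTab] at h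
  | cons x w ih =>
    have hput : colTab (x :: w) 0 = colPut (WithTop.some x) (colTab w 0) := rfl
    rw [hput, colPut, Function.update_apply] at h
    split_ifs at h with hj
    · obtain ⟨d, hd, hp, hl⟩ := exists_decreasing_of_landing (fun _ _ => ih) x
      rw [WithTop.coe_inj] at h
      subst h
      exact ⟨d, hd.cons_cons x, hp, hl.trans hj.symm⟩
    · obtain ⟨d, hd, hp⟩ := ih h
      exact ⟨d, hd.cons x, hp⟩

theorem list_cons_le_cons_iff {a b : ℕ} {l m : List ℕ} :
    a :: l ≤ b :: m ↔ a < b ∨ a = b ∧ l ≤ m := by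
  rw [← not_lt, ← not_lt (a := m)]
  change ¬ List.Lex (· < ·) (b :: m) (a :: l) ↔ a < b ∨ a = b ∧ ¬ List.Lex (· < ·) m l
  rw [List.cons_lex_cons_iff]
  rcases lt_trichotomy a b with h | rfl | h
  · simp [h, h.not_gt, h.ne']
  · simp
  · simp [h, h.not_gt, h.ne']

/-- `S` is decreasing and lexicographically at most any decreasing subsequence of `w` of the
same length. -/
def IsLexMin (w S : List ℕ) : Prop :=
  S.Pairwise (· > ·) ∧
    ∀ d : List ℕ, d.Sublist w → d.Pairwise (· > ·) → d.length = S.length → S ≤ d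

/-- `IsLexMin` does not ask S to be a subsequence of w, so it passes to suffixes. -/
theorem IsLexMin.of_cons {x : ℕ} {w S : List ℕ} (h : IsLexMin (x :: w) S) : IsLexMin w S :=
  ⟨h.1, fun d hd => h.2 d (hd.cons x)⟩

/-- A competitor of S whose head is below x extends by x to a competitor of x :: S; any other has a
head larger than that of S. -/
theorem IsLexMin.tail {x : ℕ} {w S : List ℕ} (h : IsLexMin (x :: w) (x :: S)) :
    IsLexMin w S := by
  have hp := List.pairwise_cons.1 h.1
  refine ⟨hp.2, fun d hd hdp hl => ?_⟩
  rcases S with _ | ⟨y, S⟩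
  · rw [List.length_eq_zero_iff.1 hl]
  · rcases d with _ | ⟨e, d⟩
    · simp at hl
    · have hy : y < x := hp.1 y (by simp)
      rcases lt_or_ge e x with he | he
      · have := h.2 (x :: e :: d) (hd.cons_cons x) (List.pairwise_cons.2 ⟨fun z hz => ?_, hdp⟩)
          (by simpa using hl)
        · rw [list_cons_le_cons_iff] at this
          simpa using this
        · rcases List.mem_cons.1 hz with rfl | hz
          · exact he
          · exact ((List.pairwise_cons.1 hdp).1 z hz).trans he
      · exact list_cons_le_cons_iff.2 (.inl (hy.trans_le he))

theorem IsLexMin.head_le {s c : ℕ} {w S d : List ℕ} (h : IsLexMin w (s :: S))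
    (hd : (c :: d).Sublist w) (hp : (c :: d).Pairwise (· > ·)) (hl : d.length = S.length) :
    s ≤ c := by
  have := h.2 _ hd hp (by simpa using hl)
  rw [list_cons_le_cons_iff] at this
  rcases this with h | h
  · exact h.le
  · exact h.1.le

/-! ### The left-shift on lists of squares -/

/-- `Shift L S O`: the squares of the subsequence `S` of `L` except the first one are moved,
within their rows, to the column of the previous square of `S`, the first one is removed, and
this turns `L` into `O`. -/
inductive Shift : List (ℕ × ℕ) → List (ℕ × ℕ) → List (ℕ × ℕ) → Prop
  | nil : Shift [] [] []
  | skip (X : ℕ × ℕ) {L S O : List (ℕ × ℕ)} (h : Shift L S O) : Shift (X :: L) S (X :: O)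
  | last (X : ℕ × ℕ) {L O : List (ℕ × ℕ)} (h : Shift L [] O) : Shift (X :: L) [X] O
  | move (X Y : ℕ × ℕ) {L S O : List (ℕ × ℕ)} (h : Shift L (Y :: S) O) :
      Shift (X :: L) (X :: Y :: S) ((X.1, Y.2) :: O)

theorem exists_shift {L S : List (ℕ × ℕ)} (h : S.Sublist L) : ∃ O, Shift L S O := by
  induction h with
  | slnil => exact ⟨_, .nil⟩
  | cons X _ ih => exact ⟨_, ih.choose_spec.skip X⟩
  | @cons_cons S L X _ ih =>
    obtain ⟨O, hO⟩ := ih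
    rcases S with _ | ⟨Y, S⟩
    · exact ⟨_, hO.last X⟩
    · exact ⟨_, hO.move X Y⟩

theorem Shift.eq_of_nil {L O : List (ℕ × ℕ)} (h : Shift L [] O) : O = L := by
  generalize hS : ([] : List (ℕ × ℕ)) = S at h
  induction h with
  | nil => rfl
  | skip X _ ih => rw [ih hS]
  | last => simp at hS
  | move => simp at hS

/-- The invariant of the reading from right to left: the head of S is the delayed letter, and its
slot counts the squares of S after it. -/
theorem Shift.slide {L S O : List (ℕ × ℕ)} (h : Shift L S O) (hL : (L.map Prod.snd).Nodup)
    (hmin : IsLexMin (L.map Prod.snd) (S.map Prod.snd)) {s : ℕ × ℕ} {S' : List (ℕ × ℕ)}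
    (hS : S = s :: S') :
    colTab (L.map Prod.snd) 0 S'.length = WithTop.some s.2 ∧
      ∀ n, Slide n S'.length (colTab (L.map Prod.snd)) (colTab (O.map Prod.snd)) := by
  induction h generalizing s S' with
  | nil => simp at hS
  | @skip X L S O h ih =>
    subst hS
    rw [List.map_cons, List.nodup_cons] at hL
    rw [List.map_cons] at hmin
    obtain ⟨h1, h2⟩ := ih hL.2 hmin.of_cons rfl
    have hT := isTab_colTab (L.map Prod.snd)
    -- If X landed in the slot of s, it would start a decreasing sequence as long as S, so s.2 ≤ X.2
    -- by minimality. Landing gives X.2 ≤ s.2, and the rows are distinct.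
    have hne : landing (WithTop.some X.2) (colTab (L.map Prod.snd) 0) ≠
        S'.length := by
      intro hl
      obtain ⟨d, hd, hp, hdl⟩ :=
        exists_decreasing_of_landing (fun _ _ => exists_decreasing_of_colTab) X.2
      have h3 : s.2 ≤ X.2 := hmin.head_le (hd.cons_cons _) hp (by rw [hdl, hl, List.length_map])
      have h4 := (hT.isCol 0).le_landing (WithTop.some X.2)
      rw [hl, h1, WithTop.coe_le_coe] at h4
      obtain ⟨e, he, -⟩ := exists_decreasing_of_colTab h1
      rw [le_antisymm h3 h4] at he
      exact hL.1 (he.subset (by simp))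
    refine ⟨?_, fun n => ?_⟩
    · rw [List.map_cons, colTab, tabInsert, bumpSeq, colPut, Function.update_of_ne hne.symm, h1]
    · exact Slide.tabInsert_of_ne hT (isTab_colTab _) h2 hne n
  | @last X L O h ih =>
    obtain ⟨rfl, rfl⟩ := List.cons.inj hS
    rw [h.eq_of_nil]
    have h0 : WithTop.some X.2 ≤ colTab (L.map Prod.snd) 0 0 := by
      by_contra! hlt
      obtain ⟨c, hc⟩ := WithTop.ne_top_iff_exists.1 (hlt.trans (WithTop.coe_lt_top _)).ne
      obtain ⟨d, hd, hp, hdl⟩ := exists_decreasing_of_colTab hc.symm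
      have := hmin.head_le (hd.cons X.2) hp (by simpa using hdl)
      rw [← hc, WithTop.coe_lt_coe] at hlt
      omega
    refine ⟨?_, fun n => slide_tabInsert_self (isTab_colTab _) h0 n⟩
    rw [List.map_cons, colTab, tabInsert, bumpSeq, colPut, Nat.le_zero.1 (landing_le h0)]
    exact Function.update_self ..
  | @move X Y L S O h ih =>
    obtain ⟨rfl, rfl⟩ := List.cons.inj hS
    rw [List.map_cons, List.nodup_cons] at hL
    rw [List.map_cons, List.map_cons] at hmin
    obtain ⟨h1, h2⟩ := ih hL.2 hmin.tail rfl
    have hYX : Y.2 < X.2 := (List.pairwise_cons.1 hmin.1).1 Y.2 (by simp)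
    have h3 : colTab (L.map Prod.snd) 0 S.length < WithTop.some X.2 := by rw [h1]; exact WithTop.coe_lt_coe.2 hYX
    -- A smaller entry in this slot would start a sequence of the same length as X :: Y :: S with a
    -- smaller head. So X lands just after Y.
    have h4 : WithTop.some X.2 ≤ colTab (L.map Prod.snd) 0 (S.length + 1) := by
      by_contra! hlt
      obtain ⟨c, hc⟩ := WithTop.ne_top_iff_exists.1 (hlt.trans (WithTop.coe_lt_top _)).ne
      obtain ⟨d, hd, hp, hdl⟩ := exists_decreasing_of_colTab hc.symm
      have := hmin.head_le (hd.cons X.2) hp (by simpa using hdl)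
      rw [← hc, WithTop.coe_lt_coe] at hlt
      omega
    have hT := isTab_colTab (L.map Prod.snd)
    refine ⟨?_, fun n => ?_⟩
    · rw [List.map_cons, colTab, tabInsert, bumpSeq, colPut, List.length_cons, landing_eq _ h4]
      · exact Function.update_self ..
      · intro i hi
        exact ((hT.isCol 0).le (Nat.le_of_lt_succ hi)).trans_lt h3
    · have := Slide.tabInsert_succ hT (isTab_colTab _) h2 h3 h4 n
      rw [h1] at this
      exact this

/-- The left-shift of a longest, lexicographically smallest decreasing subsequence yields an
equivalent word. -/
theorem Shift.wordEquiv {L S O : List (ℕ × ℕ)} {s : ℕ × ℕ} (h : Shift L (s :: S) O)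
    (hL : (L.map Prod.snd).Nodup) (hmin : IsLexMin (L.map Prod.snd) ((s :: S).map Prod.snd))
    (hmax : ∀ d : List ℕ, d.Sublist (L.map Prod.snd) → d.Pairwise (· > ·) →
      d.length ≤ S.length + 1) :
    WordEquiv (L.map Prod.snd) (s.2 :: O.map Prod.snd) := by
  obtain ⟨h1, h2⟩ := h.slide hL hmin rfl
  have hT := isTab_colTab (L.map Prod.snd)
  have htop : colTab (L.map Prod.snd) 0 (S.length + 1) = ⊤ := by
    by_contra hne
    obtain ⟨c, hc⟩ := WithTop.ne_top_iff_exists.1 hne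
    obtain ⟨d, hd, hp, hdl⟩ := exists_decreasing_of_colTab hc.symm
    have := hmax _ hd hp
    simp [hdl] at this
  refine wordEquiv_of_colTab_eq (funext fun j => ?_)
  -- Inserting `⊤` leaves the unshifted tableau alone, yet it advances the hole to an empty slot.
  have h3 := Slide.tabInsert_succ hT (isTab_colTab _) h2 (z := ⊤)
    (by rw [h1]; exact WithTop.coe_lt_top _) (by rw [htop]) (j + 1)
  rw [hT.tabInsert_top, h1] at h3
  exact (Slide.eq_of_top hT htop h3 (Nat.lt_succ_self j)).symm

/-! ### From placements to lists of squares -/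

theorem word_toFinset {L : List (ℕ × ℕ)} (hL : L.Pairwise fun X Y => X.1 < Y.1) :
    word L.toFinset = L.map Prod.snd := by
  have h1 : (L.map toLex).Pairwise (· < ·) := by
    rw [List.pairwise_map]
    exact hL.imp fun {X Y} h => Prod.Lex.toLex_lt_toLex.2 (.inl h)
  have h2 : L.toFinset.map toLex.toEmbedding = (L.map toLex).toFinset := by
    ext X
    rw [Finset.mem_map, List.mem_toFinset, List.mem_map]
    simp only [List.mem_toFinset]
    rfl
  have h3 : (L.map toLex).toFinset.sort (· ≤ ·) = L.map toLex :=
    (List.toFinset_sort (r := (· ≤ ·)) (h1.imp fun h => h.ne)).2 (h1.imp fun h => h.le)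
  rw [word, h2, h3, List.map_map]
  rfl

theorem exists_list_toFinset_eq {P : Finset (ℕ × ℕ)}
    (hP : ∀ X ∈ P, ∀ Y ∈ P, X.1 = Y.1 → X = Y) :
    ∃ L : List (ℕ × ℕ), (L.Pairwise fun X Y => X.1 < Y.1) ∧ L.toFinset = P := by
  refine ⟨((P.map toLex.toEmbedding).sort (· ≤ ·)).map ofLex, ?_, ?_⟩
  · rw [List.pairwise_map]
    have h1 := (P.map toLex.toEmbedding).sortedLT_sort.pairwise
    refine h1.imp_of_mem fun {X Y} hX hY h => ?_
    have hX' : ofLex X ∈ P := by simpa using hX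
    have hY' : ofLex Y ∈ P := by simpa using hY
    rcases Prod.Lex.lt_iff.1 h with h2 | ⟨h2, h3⟩
    · exact h2
    · rw [hP _ hX' _ hY' h2] at h3
      exact absurd h3 (lt_irrefl _)
  · ext X
    simp

theorem Shift.sublist_fst {L S O : List (ℕ × ℕ)} (h : Shift L S O) :
    (O.map Prod.fst).Sublist (L.map Prod.fst) := by
  induction h with
  | nil => exact .slnil
  | skip X _ ih => exact ih.cons_cons X.1
  | last X _ ih => exact ih.cons X.1
  | move X Y _ ih => exact ih.cons_cons X.1

theorem Shift.subset {L S O : List (ℕ × ℕ)} (h : Shift L S O) : S ⊆ L := by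
  induction h with
  | nil => simp
  | skip X _ ih => exact List.subset_cons_of_subset X ih
  | last X _ ih => simp
  | move X Y _ ih => exact List.cons_subset_cons X ih

/-- The tail does not depend on c; c is arbitrary so that the induction can take the column of X for
it. -/
theorem Shift.mem_iff {L S O : List (ℕ × ℕ)} (h : Shift L S O) (hL : L.Nodup) (c : ℕ)
    (Z : ℕ × ℕ) : Z ∈ O ↔ Z ∈ L ∧ Z ∉ S ∨ Z ∈ (leftShiftSeq c S).tail := by
  induction h generalizing c with
  | nil => simp [leftShiftSeq]
  | @skip X L S O h ih =>
    rw [List.nodup_cons] at hL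
    have hX : X ∉ S := fun hX => hL.1 (h.subset hX)
    rw [List.mem_cons, List.mem_cons, ih hL.2 c]
    by_cases hZ : Z = X
    · simp [hZ, hX]
    · simp [hZ]
  | @last X L O h ih =>
    rw [List.nodup_cons] at hL
    rw [h.eq_of_nil]
    by_cases hZ : Z = X
    · simp [hZ, leftShiftSeq, hL.1]
    · simp [hZ, leftShiftSeq]
  | @move X Y L S O h ih =>
    rw [List.nodup_cons] at hL
    rw [List.mem_cons, ih hL.2 X.1]
    have hs : (leftShiftSeq c (X :: Y :: S)).tail =
      (X.1, Y.2) :: (leftShiftSeq X.1 (Y :: S)).tail := rfl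
    rw [hs]
    simp only [List.mem_cons]
    by_cases hZ : Z = X
    · subst hZ
      simp [hL.1]
    · simp only [hZ, false_or]
      tauto

theorem ins_eq_of_wordEquiv {u v w w' : List ℕ} {P Q : Finset (ℕ × ℕ)} (h : WordEquiv w w')
    (hP : word P = u ++ w ++ v) (hQ : word Q = u ++ w' ++ v) : ins P = ins Q := by
  have h' := ((WordEquiv.refl u).append h).append (.refl v) [] (by simp [RowsSorted])
  rw [← hP, ← hQ] at h'
  exact h'

theorem isDecreasingSeq_of_sublist {Q : Finset (ℕ × ℕ)} {M : List (ℕ × ℕ)}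
    (hM : M.Pairwise fun X Y => X.1 < Y.1) (hQ : M.toFinset = Q) {d : List ℕ}
    (hd : d.Sublist (M.map Prod.snd)) (hp : d.Pairwise (· > ·)) :
    ∃ T, IsDecreasingSeq Q T ∧ T.map Prod.snd = d := by
  obtain ⟨T, hT, rfl⟩ := List.sublist_map_iff.1 hd
  rw [List.pairwise_map] at hp
  refine ⟨T, ⟨fun X hX => ?_, ((hM.sublist hT).and hp)⟩, rfl⟩
  rw [← hQ, List.mem_toFinset]
  exact hT.subset hX

theorem IsDecreasingSeq.sublist {Q : Finset (ℕ × ℕ)} {M S : List (ℕ × ℕ)}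
    (hM : M.Pairwise fun X Y => X.1 < Y.1) (hQ : M.toFinset = Q) (hS : IsDecreasingSeq Q S) :
    S.Sublist M := by
  have hlex : ∀ L : List (ℕ × ℕ), (L.Pairwise fun X Y => X.1 < Y.1) →
      (L.map toLex).Pairwise (· < ·) := fun L hL => by
    rw [List.pairwise_map]
    exact hL.imp fun {X Y} h => Prod.Lex.toLex_lt_toLex.2 (.inl h)
  have h1 := hlex M hM
  have h2 := hlex S (hS.2.imp fun h => h.1)
  have h3 : (S.map toLex).Sublist (M.map toLex) := by
    refine List.sublist_of_subperm_of_pairwise ?_ (h2.imp fun h => h.le) (h1.imp fun h => h.le)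
    refine List.subperm_of_subset (h2.imp fun h => h.ne) (List.map_subset _ fun X hX => ?_)
    rw [← List.mem_toFinset, hQ]
    exact hS.1 X hX
  have hid : ∀ L : List (ℕ × ℕ), (L.map toLex).map ofLex = L := fun L => by
    rw [List.map_map]
    exact List.map_id L
  have h4 := h3.map ofLex
  rwa [hid, hid] at h4

end RookPlacement

theorem mainTheorem6 (n m : ℕ) (P : Finset (ℕ × ℕ))
    (hP : RookPlacement.IsPlacement (RookPlacement.rectBoard n m) P)
    (a b : ℕ) (ha : 1 ≤ a) (hab : a < b) (hb : b ≤ n)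
    (hempty : ∀ X ∈ P, X.1 ≠ a) :
    RookPlacement.ins P =
      RookPlacement.ins (RookPlacement.leftShift P a (RookPlacement.ds a b P)) := by
  open RookPlacement in
  obtain ⟨⟨hdec, hlong⟩, hlex⟩ := ds_spec a b P
  generalize ds a b P = S at hdec hlong hlex
  obtain ⟨-, hcol, hrow⟩ := hP
  obtain ⟨U, hU, hU'⟩ := exists_list_toFinset_eq (P := P.filter fun X => X.1 < a)
    fun X hX Y hY => hcol X (Finset.mem_of_mem_filter X hX) Y (Finset.mem_of_mem_filter Y hY)
  obtain ⟨V, hV, hV'⟩ := exists_list_toFinset_eq (P := P.filter fun X => b < X.1)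
    fun X hX Y hY => hcol X (Finset.mem_of_mem_filter X hX) Y (Finset.mem_of_mem_filter Y hY)
  obtain ⟨M, hM, hM'⟩ := exists_list_toFinset_eq (P := restrictCols a b P)
    fun X hX Y hY => hcol X (Finset.mem_of_mem_filter X hX) Y (Finset.mem_of_mem_filter Y hY)
  have memU : ∀ X, X ∈ U ↔ X ∈ P ∧ X.1 < a := fun X => by
    rw [← List.mem_toFinset, hU', Finset.mem_filter]
  have memV : ∀ X, X ∈ V ↔ X ∈ P ∧ b < X.1 := fun X => by
    rw [← List.mem_toFinset, hV', Finset.mem_filter]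
  have memM : ∀ X, X ∈ M ↔ X ∈ P ∧ a ≤ X.1 ∧ X.1 ≤ b := fun X => by
    rw [← List.mem_toFinset, hM', restrictCols, Finset.mem_filter]
  have hSM : S.Sublist M := hdec.sublist hM hM'
  rcases S with _ | ⟨s, S⟩
  · simp [leftShift, leftShiftSeq]
  obtain ⟨O, hO⟩ := exists_shift hSM
  have hMnd : M.Nodup := hM.imp fun {X Y} h e => by simp [e] at h
  have hMrows : (M.map Prod.snd).Nodup := by
    rw [List.nodup_map_iff_inj_on hMnd]
    exact fun X hX Y hY h => hrow X ((memM X).1 hX).1 Y ((memM Y).1 hY).1 h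
  have hmin : IsLexMin (M.map Prod.snd) ((s :: S).map Prod.snd) := by
    refine ⟨?_, fun d hd hp hl => ?_⟩
    · rw [List.pairwise_map]
      exact hdec.2.imp fun h => h.2
    · obtain ⟨T, hT, rfl⟩ := isDecreasingSeq_of_sublist hM hM' hd hp
      rw [List.length_map, List.length_map] at hl
      exact hlex T ⟨hT, fun T' hT' => hl ▸ hlong T' hT'⟩
  have hmax : ∀ d : List ℕ, d.Sublist (M.map Prod.snd) → d.Pairwise (· > ·) →
      d.length ≤ S.length + 1 := by
    intro d hd hp
    obtain ⟨T, hT, rfl⟩ := isDecreasingSeq_of_sublist hM hM' hd hp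
    simpa using hlong T hT
  -- The shift only reuses old columns, and column a is empty, so the square (a, s.2) can be put in
  -- front.
  have hOcol : ∀ Z ∈ O, a < Z.1 ∧ Z.1 ≤ b := by
    intro Z hZ
    obtain ⟨X, hX, hXZ⟩ := List.mem_map.1 (hO.sublist_fst.subset (List.mem_map_of_mem hZ))
    obtain ⟨h1, h2, h3⟩ := (memM X).1 hX
    have := hempty X h1
    omega
  have hOp : ((a, s.2) :: O).Pairwise fun X Y => X.1 < Y.1 := by
    refine List.pairwise_cons.2 ⟨fun Z hZ => (hOcol Z hZ).1, ?_⟩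
    have h1 : (M.map Prod.fst).Pairwise (· < ·) := List.pairwise_map.2 hM
    exact List.pairwise_map.1 (h1.sublist hO.sublist_fst)
  -- the word of a placement that agrees with `P` outside of the columns `a, …, b`
  have key : ∀ (N : List (ℕ × ℕ)) (Q : Finset (ℕ × ℕ)), (N.Pairwise fun X Y => X.1 < Y.1) →
      (∀ X ∈ N, a ≤ X.1 ∧ X.1 ≤ b) → (∀ X, X ∈ Q ↔ X ∈ U ∨ X ∈ N ∨ X ∈ V) →
      word Q = U.map Prod.snd ++ N.map Prod.snd ++ V.map Prod.snd := by
    intro N Q hN hN' hQ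
    have hQ' : Q = (U ++ N ++ V).toFinset := by
      ext X
      rw [hQ, List.mem_toFinset, List.mem_append, List.mem_append, or_assoc]
    rw [hQ', word_toFinset, List.map_append, List.map_append]
    refine List.pairwise_append.2 ⟨List.pairwise_append.2 ⟨hU, hN, ?_⟩, hV, ?_⟩
    · exact fun X hX Y hY => ((memU X).1 hX).2.trans_le (hN' Y hY).1
    · intro X hX Y hY
      have h1 := ((memV Y).1 hY).2
      rcases List.mem_append.1 hX with hX | hX
      · exact (((memU X).1 hX).2.trans hab).trans h1
      · exact (hN' X hX).2.trans_lt h1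
  refine ins_eq_of_wordEquiv (hO.wordEquiv hMrows hmin hmax)
    (key M P hM (fun X hX => ((memM X).1 hX).2) fun X => ?_)
    (key ((a, s.2) :: O) _ hOp (fun X hX => ?_) fun X => ?_)
  · rw [memU, memM, memV, ← and_or_left, ← and_or_left, iff_self_and]
    omega
  · rcases List.mem_cons.1 hX with rfl | hX
    · exact ⟨le_rfl, hab.le⟩
    · exact ⟨(hOcol X hX).1.le, (hOcol X hX).2⟩
  · have hseq : leftShiftSeq a (s :: S) = (a, s.2) :: (leftShiftSeq a (s :: S)).tail := rfl
    have hS : X ∈ s :: S → a ≤ X.1 ∧ X.1 ≤ b := fun hX => ((memM X).1 (hSM.subset hX)).2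
    rw [leftShift, Finset.mem_union, Finset.mem_sdiff, List.mem_toFinset, List.mem_toFinset, hseq,
      List.mem_cons (b := (a, s.2)), List.mem_cons (b := (a, s.2)), hO.mem_iff hMnd a, memU, memM,
      memV]
    have hcases : X.1 < a ∨ (a ≤ X.1 ∧ X.1 ≤ b) ∨ b < X.1 := by omega
    have h1 : X.1 < a → ¬ a ≤ X.1 := not_le.2
    have h2 : b < X.1 → ¬ X.1 ≤ b := not_le.2
    clear * - hcases h1 h2 hS
    tauto
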